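/- Let $\mathcal{N}$ be a quantum channel on $2\times 2$ complex matrices, i.e. a completely positive, trace-preserving linear map, and suppose that $\mathcal{N}$ is unital ($\mathcal{N}(\mathbb{1})=\mathbb{1}$) or has Choi rank at most $2$, the Choi rank being the rank of $\sum_{i,j}|i\rangle\langle j|\otimes\mathcal{N}(|i\rangle\langle j|)$. Let $\rho=\mathbb{1}/2$ be the maximally mixed qubit state, let $\sigma_0=\mathbb{1},\sigma_1,\sigma_2,\sigma_3$ be the Pauli matrices, put $\Pi_\alpha^{\pm}=\frac12(\mathbb{1}\pm\sigma_\alpha)$, and let $$R_{AB}=\frac14\sum_{\alpha,\beta=0}^{3}\langle\sigma_\alpha,\sigma_\beta\rangle\,\sigma_\alpha\otimes\sigma_\beta,\qquad \langle\sigma_\alpha,\sigma_\beta\rangle=\operatorname{Tr}\big[\mathcal{N}(\Pi_\alpha^{+}\rho\,\Pi_\alpha^{+})\sigma_\beta\big]-\operatorname{Tr}\big[\mathcal{N}(\Pi_\alpha^{-}\rho\,\Pi_\alpha^{-})\sigma_\beta\big],$$ be the 2-time pseudo-density matrix of a qubit with initial state $\rho$ that evolves by $\mathcal{N}$ between the two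 measurements. For a Hermitian matrix $X$ let $S(X)=-\operatorname{Tr}[X\log_2|X|]$ (with $0\log_2 0=0$), and let $$I(A:B)=S(R_A)+S(R_B)-S(R_{AB}),\qquad R_A=\operatorname{Tr}_B R_{AB},\quad R_B=\operatorname{Tr}_A R_{AB},$$ be the mutual information in time. Then $0\leq I(A:B)\leq 1$. -/

import Mathlib

open scoped Kronecker ComplexOrder

namespace TemporalInformation

noncomputable section

/-- Operators on the Hilbert space `ℂⁿ`, whose orthonormal basis is indexed by `n`. -/
abbrev Op (n : Type*) := Matrix n n ℂ

/-- The partial trace over the second tensor factor. -/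
def traceRight {m n : Type*} [Fintype n] (X : Op (m × n)) : Op m :=
  Matrix.of fun i j => ∑ k, X (i, k) (j, k)

/-- The partial trace over the first tensor factor. -/
def traceLeft {m n : Type*} [Fintype m] (X : Op (m × n)) : Op n :=
  Matrix.of fun i j => ∑ k, X (k, i) (k, j)

/-- The map `id ⊗ N` on operators on `ℂᵏ ⊗ ℂⁿ`: apply `N` to every block. -/
def ampliate {n : Type*} (k : ℕ) (N : Op n →ₗ[ℂ] Op n) (X : Op (Fin k × n)) :
    Op (Fin k × n) :=
  Matrix.of fun p q => N (Matrix.of fun a b => X (p.1, a) (q.1, b)) p.2 q.2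

/-- Complete positivity: `id ⊗ N` preserves positive semidefiniteness for every dimension
of the ancilla. -/
def IsCompletelyPositive {n : Type*} (N : Op n →ₗ[ℂ] Op n) : Prop :=
  ∀ (k : ℕ) (X : Op (Fin k × n)), X.PosSemidef → (ampliate k N X).PosSemidef

/-- Quantum channels: completely positive, trace-preserving linear maps. -/
structure IsChannel {n : Type*} [Fintype n] (N : Op n →ₗ[ℂ] Op n) : Prop where
  completelyPositive : IsCompletelyPositive N
  tracePreserving : ∀ X, (N X).trace = X.trace

/-- Unital maps: the identity is preserved. -/
def IsUnital {n : Type*} [DecidableEq n] (N : Op n →ₗ[ℂ] Op n) : Prop :=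
  N 1 = 1

/-- The Choi matrix `∑ i j, |i⟩⟨j| ⊗ N(|i⟩⟨j|)`. -/
def choiMatrix {n : Type*} [Fintype n] [DecidableEq n] (N : Op n →ₗ[ℂ] Op n) : Op (n × n) :=
  ∑ i, ∑ j, Matrix.single i j (1 : ℂ) ⊗ₖ N (Matrix.single i j 1)

/-- The Choi rank: the rank of the Choi matrix. -/
def choiRank {n : Type*} [Fintype n] [DecidableEq n] (N : Op n →ₗ[ℂ] Op n) : ℕ :=
  (choiMatrix N).rank

/-- The entropy `S(X) = - Tr[X log |X|]` of a Hermitian matrix `X`, with the logarithm to base 2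
and `0 log 0 = 0`; the matrix `log |X|` is given by the functional calculus. The trace is real
for Hermitian `X`. -/
def entropy {n : Type*} [Fintype n] [DecidableEq n] (X : Op n) : ℝ :=
  -(X * cfc (fun x : ℝ => Real.logb 2 |x|) X).trace.re

/-- The mutual information `I(A:B) = S(R_A) + S(R_B) - S(R_AB)`, where `R_A` and `R_B` are the
marginals of `R_AB`. -/
def mutualInformation {m n : Type*} [Fintype m] [DecidableEq m] [Fintype n] [DecidableEq n]
    (R : Op (m × n)) : ℝ :=
  entropy (traceRight R) + entropy (traceLeft R) - entropy R

/-- The Pauli matrices, with `pauli 0` the identity. -/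
def pauli : Fin 4 → Op (Fin 2) :=
  ![!![1, 0; 0, 1], !![0, 1; 1, 0], !![0, -Complex.I; Complex.I, 0], !![1, 0; 0, -1]]

/-- The projection `(1 + σ_α) / 2` onto the `+1`-eigenspace of `σ_α`. -/
def projPlus (α : Fin 4) : Op (Fin 2) := (1 / 2 : ℂ) • (1 + pauli α)

/-- The projection `(1 - σ_α) / 2` onto the `-1`-eigenspace of `σ_α`. -/
def projMinus (α : Fin 4) : Op (Fin 2) := (1 / 2 : ℂ) • (1 - pauli α)

/-- The two-time expectation value of measuring `σ_α` on the initial state `ρ`, evolving by `N`,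
and then measuring `σ_β`. -/
def twoTimeExpectation (N : Op (Fin 2) →ₗ[ℂ] Op (Fin 2)) (ρ : Op (Fin 2)) (α β : Fin 4) : ℂ :=
  (N (projPlus α * ρ * projPlus α) * pauli β).trace -
    (N (projMinus α * ρ * projMinus α) * pauli β).trace

/-- The 2-time pseudo-density matrix of a single qubit with initial state `ρ` which evolves
by `N` between the two measurements. -/
def pdm (N : Op (Fin 2) →ₗ[ℂ] Op (Fin 2)) (ρ : Op (Fin 2)) : Op (Fin 2 × Fin 2) :=
  (1 / 4 : ℂ) • ∑ α, ∑ β, twoTimeExpectation N ρ α β • (pauli α ⊗ₖ pauli β)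

/-- The maximally mixed state of a qubit. -/
def maximallyMixed : Op (Fin 2) := (1 / 2 : ℂ) • 1

end

end TemporalInformation

/-! The matrix `R_AB` is half a partial transpose of the Choi matrix. For a 2×2 matrix `X` and `ε =
iσ₂`, `ε Xᵀ ε† = Tr X - X`, so trace preservation gives `R_AB = 1/2 - G` with `G` a state whose rank
is at most the Choi rank. Let `p` be its four eigenvalues; with `η x = -x log x` extended oddly,
`S(R_AB) = ∑ η (1/2 - p i) / log 2`. Always `S(R_A) = 1`.

Unital case: `S(R_B) = 1`, and `1 ≤ S(R_AB) ≤ 2` follows from concavity of `η`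
(`log_two_le_sum_negMulLog_half_sub`, `sum_negMulLog_half_sub_le`). Choi rank at most 2: the
spectrum of `R_AB` is `1/2, 1/2, x, -x`, so `S(R_AB) = 1` and the mutual information is `S(R_B)`, a
qubit entropy. -/

namespace TemporalInformation

/-! ### Entropy as a sum over eigenvalues -/

section Entropy

variable {n : Type*} [Fintype n] [DecidableEq n] {A : Op n}

lemma trace_cfc (hA : A.IsHermitian) (f : ℝ → ℝ) :
    (cfc f A).trace = ∑ i, (f (hA.eigenvalues i) : ℂ) := by
  rw [hA.cfc_eq, Matrix.IsHermitian.cfc, Unitary.conjStarAlgAut_apply, Matrix.trace_mul_comm,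
    ← mul_assoc]
  simp [Matrix.trace]

lemma continuousOn_spectrum (A : Op n) (f : ℝ → ℝ) : ContinuousOn f (spectrum ℝ A) :=
  A.finite_real_spectrum.continuousOn f

lemma entropy_cfc (hA : A.IsHermitian) (f : ℝ → ℝ) :
    entropy (cfc f A) = (∑ i, Real.negMulLog (f (hA.eigenvalues i))) / Real.log 2 := by
  have ha : IsSelfAdjoint A := hA
  have hcont : ContinuousOn (fun x : ℝ => Real.logb 2 |x|) (f '' spectrum ℝ A) :=
    (A.finite_real_spectrum.image f).continuousOn _
  have hf := continuousOn_spectrum A f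
  rw [entropy, ← cfc_comp' (fun x : ℝ => Real.logb 2 |x|) f A,
    ← cfc_mul _ _ A (continuousOn_spectrum A _) (continuousOn_spectrum A _), trace_cfc hA]
  rw [← Complex.ofReal_sum, Complex.ofReal_re, Finset.sum_div, ← Finset.sum_neg_distrib]
  refine Finset.sum_congr rfl fun i _ => ?_
  -- `Real.log` already ignores signs, so `Real.negMulLog` is the odd extension needed for negative
  -- eigenvalues.
  rw [Real.logb, Real.log_abs, Real.negMulLog]
  ring

lemma entropy_eq_sum_eigenvalues (hA : A.IsHermitian) :
    entropy A = (∑ i, Real.negMulLog (hA.eigenvalues i)) / Real.log 2 := by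
  have ha : IsSelfAdjoint A := hA
  have h := entropy_cfc hA id
  rwa [cfc_id ℝ A ha] at h

lemma entropy_smul_one_sub (hA : A.IsHermitian) (r : ℝ) :
    entropy ((r : ℂ) • 1 - A) =
      (∑ i, Real.negMulLog (r - hA.eigenvalues i)) / Real.log 2 := by
  have ha : IsSelfAdjoint A := hA
  have h := entropy_cfc hA (fun x => r - x)
  rw [cfc_sub (fun _ => r) (fun x => x) A (continuousOn_spectrum A _) (continuousOn_spectrum A _),
    cfc_const r A ha, cfc_id' ℝ A ha] at h
  rw [← h]
  congr 2
  ext i j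
  simp [Matrix.algebraMap_matrix_apply, Matrix.one_apply]

lemma sum_eigenvalues_eq_one (hA : A.IsHermitian) (htr : A.trace = 1) :
    ∑ i, hA.eigenvalues i = 1 := by
  have h := hA.trace_eq_sum_eigenvalues
  rw [htr] at h
  refine Complex.ofReal_injective ?_
  rw [Complex.ofReal_sum, Complex.ofReal_one, h]
  rfl

lemma entropy_qubit_state {A : Op (Fin 2)} (hA : A.PosSemidef) (htr : A.trace = 1) :
    0 ≤ entropy A ∧ entropy A ≤ 1 := by
  have hsum := sum_eigenvalues_eq_one hA.1 htr
  have h0 := hA.eigenvalues_nonneg 0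
  have h1 := hA.eigenvalues_nonneg 1
  have hlog : 0 < Real.log 2 := Real.log_pos one_lt_two
  rw [Fin.sum_univ_two] at hsum
  have heq : hA.1.eigenvalues 1 = 1 - hA.1.eigenvalues 0 := by linarith
  rw [entropy_eq_sum_eigenvalues hA.1, Fin.sum_univ_two, heq,
    ← Real.binEntropy_eq_negMulLog_add_negMulLog_one_sub]
  exact ⟨div_nonneg (Real.binEntropy_nonneg h0 (by linarith)) hlog.le,
    (div_le_one hlog).2 Real.binEntropy_le_log_two⟩

lemma entropy_half_smul_one : entropy ((1 / 2 : ℂ) • 1 : Op (Fin 2)) = 1 := by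
  have h := entropy_smul_one_sub (A := (0 : Op (Fin 2))) Matrix.isHermitian_zero (1 / 2)
  have hz : (Matrix.isHermitian_zero (n := Fin 2) (α := ℂ)).eigenvalues = 0 :=
    Matrix.IsHermitian.eigenvalues_eq_zero_iff _ |>.2 rfl
  have hlog : Real.log 2 ≠ 0 := (Real.log_pos one_lt_two).ne'
  simp only [hz, sub_zero, Pi.zero_apply, Fin.sum_univ_two, Real.negMulLog, one_div,
    Real.log_inv] at h
  rw [one_div]
  push_cast at h
  rw [h]
  field_simp
  norm_num

end Entropy

/-! ### Inequalities for the shifted spectrum -/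

section ShiftedEntropy

open Real

lemma negMulLog_half : negMulLog (1 / 2) = log 2 / 2 := by
  rw [negMulLog, one_div, log_inv]; ring

lemma one_lt_log_four : 1 < log 4 := by
  rw [lt_log_iff_exp_lt (by norm_num)]
  exact exp_one_lt_d9.trans (by norm_num)

/-- The line is the tangent at `1/4`, the value of `1/2 - p i` for uniform `p`. -/
lemma negMulLog_le_tangent {x : ℝ} (hx : -(1 / 2) ≤ x) (hx' : x ≤ 1 / 2) :
    negMulLog x ≤ 1 / 4 + (log 4 - 1) * x := by
  have hlog : log 4 = 2 * log 2 := by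
    rw [show (4 : ℝ) = 2 ^ 2 by norm_num, log_pow]; norm_num
  rcases lt_trichotomy x 0 with h | rfl | h
  -- For negative `x` concavity is lost, but the left side is at most 0 and the line is still
  -- positive at `-1/2`, as `log 4 < 3/2`.
  · have h2 : log 2 < 0.7 := log_two_lt_d9.trans (by norm_num)
    have h1 : log x ≤ 0 := by
      rw [← log_neg_eq_log]
      exact log_nonpos (by linarith) (by linarith)
    have h3 : 0 ≤ x * log x := mul_nonneg_of_nonpos_of_nonpos h.le h1
    rw [negMulLog]
    nlinarith [one_lt_log_four]
  · simp
  · have h1 := log_le_sub_one_of_pos (show 0 < 1 / (4 * x) by positivity)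
    rw [one_div, log_inv, log_mul (by norm_num) h.ne'] at h1
    have h2 := mul_le_mul_of_nonneg_left h1 h.le
    have h3 : x * ((4 * x)⁻¹ - 1) = 1 / 4 - x := by field_simp
    rw [h3] at h2
    rw [negMulLog]
    linarith

lemma mul_log_two_le_negMulLog {x : ℝ} (hx : 0 ≤ x) (hx' : x ≤ 1 / 2) :
    x * log 2 ≤ negMulLog x := by
  rcases hx.eq_or_lt with rfl | h
  · simp
  · have h1 := log_le_log h hx'
    rw [one_div, log_inv] at h1
    rw [negMulLog]
    nlinarith

lemma negMulLog_neg (x : ℝ) : negMulLog (-x) = -negMulLog x := by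
  simp [negMulLog]

/-- A concave function vanishing at the origin is subadditive. -/
lemma negMulLog_half_sub_subadditive {a b : ℝ} (ha : 0 ≤ a) (hb : 0 ≤ b) (hab : a + b ≤ 1 / 2) :
    negMulLog (1 / 2 - (a + b)) - log 2 / 2 ≤
      (negMulLog (1 / 2 - a) - log 2 / 2) + (negMulLog (1 / 2 - b) - log 2 / 2) := by
  rcases (add_nonneg ha hb).eq_or_lt with h | h
  · have ha0 : a = 0 := by linarith
    have hb0 : b = 0 := by linarith
    subst ha0 hb0
    simp [← negMulLog_half]
  -- `1/2 - c` is a convex combination of `1/2 - (a + b)` and `1/2`.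
  · have key : ∀ c, 0 ≤ c → c ≤ a + b →
        c / (a + b) * negMulLog (1 / 2 - (a + b)) + (1 - c / (a + b)) * (log 2 / 2) ≤
          negMulLog (1 / 2 - c) := by
      intro c hc hcs
      have h1 := concaveOn_negMulLog.2
        (show 1 / 2 - (a + b) ∈ Set.Ici 0 by simp only [Set.mem_Ici]; linarith)
        (show (1 / 2 : ℝ) ∈ Set.Ici 0 by simp only [Set.mem_Ici]; norm_num)
        (show 0 ≤ c / (a + b) by positivity)
        (sub_nonneg.2 ((div_le_one h).2 hcs)) (by ring)
      simp only [smul_eq_mul, negMulLog_half] at h1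
      rwa [show c / (a + b) * (1 / 2 - (a + b)) + (1 - c / (a + b)) * (1 / 2) = 1 / 2 - c by
        field_simp; ring] at h1
    have h1 := key a ha (by linarith)
    have h2 := key b hb (by linarith)
    have h3 : b / (a + b) = 1 - a / (a + b) := by field_simp; ring
    rw [h3] at h2
    linarith

variable {ι : Type*}

lemma negMulLog_half_sub_sum_le (s : Finset ι) {p : ι → ℝ} (hp : ∀ i, 0 ≤ p i)
    (hs : ∑ i ∈ s, p i ≤ 1 / 2) :
    negMulLog (1 / 2 - ∑ i ∈ s, p i) - log 2 / 2 ≤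
      ∑ i ∈ s, (negMulLog (1 / 2 - p i) - log 2 / 2) := by
  classical
  induction s using Finset.induction_on with
  | empty => simp [← negMulLog_half]
  | insert j s hj ih =>
    rw [Finset.sum_insert hj] at hs ⊢
    rw [Finset.sum_insert hj]
    have h0 : 0 ≤ ∑ i ∈ s, p i := Finset.sum_nonneg fun i _ => hp i
    have h1 := negMulLog_half_sub_subadditive (hp j) h0 hs
    have h2 := ih (by linarith [hp j])
    linarith

variable [Fintype ι] {p : ι → ℝ}

lemma sum_negMulLog_half_sub_le (hι : Fintype.card ι = 4) (hp : ∀ i, 0 ≤ p i)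
    (hsum : ∑ i, p i = 1) : ∑ i, negMulLog (1 / 2 - p i) ≤ 2 * log 2 := by
  have hlog : log 4 = 2 * log 2 := by
    rw [show (4 : ℝ) = 2 ^ 2 by norm_num, log_pow]; norm_num
  have hle : ∀ i, p i ≤ 1 := fun i =>
    hsum ▸ Finset.single_le_sum (fun j _ => hp j) (Finset.mem_univ i)
  calc ∑ i, negMulLog (1 / 2 - p i)
      ≤ ∑ i, (1 / 4 + (log 4 - 1) * (1 / 2 - p i)) := Finset.sum_le_sum fun i _ =>
        negMulLog_le_tangent (by linarith [hle i]) (by linarith [hp i])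
    _ = 2 * log 2 := by
        rw [Finset.sum_add_distrib, ← Finset.mul_sum, Finset.sum_sub_distrib, hsum]
        simp only [Finset.sum_const, Finset.card_univ, hι, nsmul_eq_mul, hlog]
        norm_num

/-- At most one `1/2 - p j` is negative. By oddness its term cancels the term obtained by merging
the other three weights, and merging is controlled by subadditivity. With no negative term, the
chord over `[0, 1/2]` suffices. -/
lemma log_two_le_sum_negMulLog_half_sub (hι : Fintype.card ι = 4) (hp : ∀ i, 0 ≤ p i)
    (hsum : ∑ i, p i = 1) : log 2 ≤ ∑ i, negMulLog (1 / 2 - p i) := by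
  classical
  by_cases h : ∃ j, 1 / 2 < p j
  · obtain ⟨j, hj⟩ := h
    have hrest : ∑ i ∈ Finset.univ.erase j, p i = 1 - p j := by
      rw [← hsum, ← Finset.add_sum_erase _ p (Finset.mem_univ j)]; ring
    have h1 := negMulLog_half_sub_sum_le (Finset.univ.erase j) hp (by linarith)
    rw [hrest, Finset.sum_sub_distrib, Finset.sum_const, Finset.card_erase_of_mem
      (Finset.mem_univ j), Finset.card_univ, hι] at h1
    have h2 : negMulLog (1 / 2 - (1 - p j)) = -negMulLog (1 / 2 - p j) := by
      rw [← negMulLog_neg]; ring_nf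
    rw [← Finset.add_sum_erase _ _ (Finset.mem_univ j)]
    norm_num at h1 h2 ⊢
    linarith
  · push Not at h
    calc log 2 = ∑ i, (1 / 2 - p i) * log 2 := by
          rw [← Finset.sum_mul, Finset.sum_sub_distrib, hsum]
          simp only [Finset.sum_const, Finset.card_univ, hι, nsmul_eq_mul]
          norm_num
      _ ≤ _ := Finset.sum_le_sum fun i _ =>
          mul_log_two_le_negMulLog (by linarith [h i]) (by linarith [hp i])

lemma sum_negMulLog_half_sub_of_card_support_le (hι : Fintype.card ι = 4) (hsum : ∑ i, p i = 1)
    (hcard : Fintype.card {i // p i ≠ 0} ≤ 2) : ∑ i, negMulLog (1 / 2 - p i) = log 2 := by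
  classical
  rw [Fintype.card_subtype] at hcard
  -- The support is padded to exactly two indices `k`, `l`; then `p k + p l = 1` makes their terms
  -- opposite.
  obtain ⟨t, ht, htc⟩ := Finset.exists_superset_card_eq (n := 2) hcard (by omega)
  have hz : ∀ i ∉ t, p i = 0 := fun i hi => by
    by_contra h
    exact hi (ht (by simpa using h))
  obtain ⟨k, l, hkl, rfl⟩ := Finset.card_eq_two.1 htc
  rw [← Finset.sum_subset (Finset.subset_univ {k, l}) fun i _ hi => hz i hi,
    Finset.sum_pair hkl] at hsum
  rw [← Finset.sum_add_sum_compl {k, l}, Finset.sum_pair hkl,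
    Finset.sum_congr rfl (g := fun _ => log 2 / 2) fun i hi => by
      rw [hz i (Finset.mem_compl.1 hi), sub_zero, negMulLog_half],
    Finset.sum_const, Finset.card_compl, hι, htc,
    show 1 / 2 - p k = -(1 / 2 - p l) by linarith, negMulLog_neg]
  norm_num
  ring

end ShiftedEntropy

/-! ### The pseudo-density matrix and the Choi matrix -/

section Channel

variable {N : Op (Fin 2) →ₗ[ℂ] Op (Fin 2)}

lemma choiMatrix_apply {n : Type*} [Fintype n] [DecidableEq n] (N : Op n →ₗ[ℂ] Op n)
    (p q : n × n) : choiMatrix N p q = N (Matrix.single p.1 q.1 1) p.2 q.2 := by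
  simp [choiMatrix, Matrix.sum_apply, Matrix.single_apply, ite_and]

lemma choiMatrix_posSemidef (hN : IsCompletelyPositive N) : (choiMatrix N).PosSemidef := by
  -- The input is the unnormalised maximally entangled projector.
  have h := hN 2 _ (Matrix.posSemidef_vecMulVec_self_star
    (fun p : Fin 2 × Fin 2 => if p.1 = p.2 then (1 : ℂ) else 0))
  convert h using 1
  refine Matrix.ext fun p q => ?_
  rw [choiMatrix_apply, ampliate, Matrix.of_apply]
  refine congrArg (fun X => N X p.2 q.2) (Matrix.ext fun a b => ?_)
  simp only [Matrix.single_apply, Matrix.vecMulVec_apply, Matrix.of_apply, Pi.star_apply]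
  split_ifs <;> simp_all

lemma map_eq_sum_single (N : Op (Fin 2) →ₗ[ℂ] Op (Fin 2)) (X : Op (Fin 2)) :
    N X = ∑ i, ∑ j, X i j • N (Matrix.single i j 1) := by
  conv_lhs => rw [Matrix.matrix_eq_sum_single X]
  simp only [map_sum, ← map_smul, Matrix.smul_single, smul_eq_mul, mul_one]

lemma measured_difference (α : Fin 4) :
    projPlus α * maximallyMixed * projPlus α - projMinus α * maximallyMixed * projMinus α =
      (1 / 2 : ℂ) • pauli α := by
  have hsq : pauli α * pauli α = 1 := by
    fin_cases α <;> ext i j <;> fin_cases i <;> fin_cases j <;> simp [pauli]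
  simp only [projPlus, projMinus, maximallyMixed, smul_mul_assoc, mul_smul_comm, mul_one, add_mul,
    mul_add, sub_mul, mul_sub, one_mul, hsq]
  module

lemma twoTimeExpectation_maximallyMixed (N : Op (Fin 2) →ₗ[ℂ] Op (Fin 2)) (α β : Fin 4) :
    twoTimeExpectation N maximallyMixed α β = 1 / 2 * (N (pauli α) * pauli β).trace := by
  rw [twoTimeExpectation, ← Matrix.trace_sub, ← sub_mul, ← map_sub, measured_difference, map_smul,
    smul_mul_assoc, Matrix.trace_smul, smul_eq_mul]

lemma pdm_maximallyMixed_apply (N : Op (Fin 2) →ₗ[ℂ] Op (Fin 2)) (p q : Fin 2 × Fin 2) :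
    pdm N maximallyMixed p q = 1 / 2 * N (Matrix.single q.1 p.1 1) p.2 q.2 := by
  obtain ⟨i, a⟩ := p
  obtain ⟨j, b⟩ := q
  simp only [pdm, twoTimeExpectation_maximallyMixed]
  simp_rw [fun α => map_eq_sum_single N (pauli α)]
  simp only [pauli]
  fin_cases i <;> fin_cases j <;> fin_cases a <;> fin_cases b <;>
    simp [Fin.sum_univ_four, Fin.sum_univ_two, Matrix.trace, Matrix.mul_apply] <;>
    ring_nf <;> simp [Complex.I_sq] <;> ring

/-- The spin flip `1 ⊗ iσ₂` on the second qubit. -/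
def spinFlip : Op (Fin 2 × Fin 2) := 1 ⊗ₖ !![0, 1; -1, 0]

/-- The spin-flipped transpose of the Choi state. -/
noncomputable def flippedChoi (N : Op (Fin 2) →ₗ[ℂ] Op (Fin 2)) : Op (Fin 2 × Fin 2) :=
  (1 / 2 : ℂ) • (spinFlip * (choiMatrix N).transpose * spinFlip.conjTranspose)

lemma trace_single (hN : ∀ X, (N X).trace = X.trace) (i j : Fin 2) :
    N (Matrix.single i j 1) 0 0 + N (Matrix.single i j 1) 1 1 = if i = j then 1 else 0 := by
  have h := hN (Matrix.single i j 1)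
  rw [Matrix.trace_fin_two] at h
  rw [h]
  split_ifs with hij
  · subst hij; simp
  · exact Matrix.trace_single_eq_of_ne _ _ _ hij

/-- Blockwise this is `ε Xᵀ ε† = Tr X - X` for `X = N |j⟩⟨i|`, whose trace is `δᵢⱼ`. -/
lemma pdm_eq_half_sub_flippedChoi (hN : ∀ X, (N X).trace = X.trace) :
    pdm N maximallyMixed = ((1 / 2 : ℝ) : ℂ) • 1 - flippedChoi N := by
  ext ⟨i, a⟩ ⟨j, b⟩
  have h := trace_single hN j i
  rw [pdm_maximallyMixed_apply]
  simp only [flippedChoi, spinFlip, Matrix.sub_apply, Matrix.smul_apply, Matrix.mul_apply,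
    Fintype.sum_prod_type, Fin.sum_univ_two, Matrix.transpose_apply, choiMatrix_apply,
    Matrix.conjTranspose_apply, Matrix.kroneckerMap_apply]
  fin_cases i <;> fin_cases j <;> fin_cases a <;> fin_cases b <;>
    simp [Matrix.one_apply] at h ⊢ <;> linear_combination (1 / 2 : ℂ) * h

lemma flippedChoi_posSemidef (hN : IsCompletelyPositive N) : (flippedChoi N).PosSemidef :=
  ((choiMatrix_posSemidef hN).transpose.mul_mul_conjTranspose_same spinFlip).smul
    (by norm_num [Complex.le_def])

lemma trace_flippedChoi (hN : ∀ X, (N X).trace = X.trace) : (flippedChoi N).trace = 1 := by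
  have h := congrArg Matrix.trace (pdm_eq_half_sub_flippedChoi hN)
  have h0 := trace_single hN 0 0
  have h1 := trace_single hN 1 1
  simp [Matrix.trace_sub, Matrix.trace_smul] at h
  simp [Matrix.trace, Fintype.sum_prod_type, pdm_maximallyMixed_apply] at h h0 h1 ⊢
  linear_combination h - h0 / 2 - h1 / 2

lemma rank_flippedChoi_le : (flippedChoi N).rank ≤ choiRank N := by
  rw [flippedChoi, ← smul_mul_assoc, ← mul_smul_comm]
  refine (Matrix.rank_mul_le_left _ _).trans ((Matrix.rank_mul_le_right _ _).trans ?_)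
  rw [← Matrix.transpose_smul, Matrix.rank_transpose, choiRank,
    ← one_mul (choiMatrix N), ← smul_mul_assoc, one_mul]
  exact Matrix.rank_mul_le_right _ _

lemma traceRight_pdm (hN : ∀ X, (N X).trace = X.trace) :
    traceRight (pdm N maximallyMixed) = (1 / 2 : ℂ) • 1 := by
  ext i j
  have h := trace_single hN j i
  simp only [traceRight, Matrix.of_apply, pdm_maximallyMixed_apply, Fin.sum_univ_two,
    ← mul_add, h, Matrix.smul_apply, Matrix.one_apply, smul_eq_mul, eq_comm]

lemma traceLeft_pdm : traceLeft (pdm N maximallyMixed) = (1 / 2 : ℂ) • N 1 := by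
  ext a b
  simp [traceLeft, pdm_maximallyMixed_apply, map_eq_sum_single N 1, mul_add]

lemma map_one_posSemidef (hN : IsCompletelyPositive N) : (N 1).PosSemidef := by
  have h : N 1 = ∑ k, (choiMatrix N).submatrix (Prod.mk k) (Prod.mk k) := by
    ext a b
    simp [map_eq_sum_single N 1, Matrix.sum_apply, choiMatrix_apply]
  rw [h]
  exact Matrix.posSemidef_sum _ fun k _ => (choiMatrix_posSemidef hN).submatrix _

end Channel

end TemporalInformation

open TemporalInformation in
theorem theorem2 (N : Matrix (Fin 2) (Fin 2) ℂ →ₗ[ℂ] Matrix (Fin 2) (Fin 2) ℂ)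
    (hN : IsChannel N) (h : IsUnital N ∨ choiRank N ≤ 2) :
    0 ≤ mutualInformation (pdm N maximallyMixed) ∧
      mutualInformation (pdm N maximallyMixed) ≤ 1 := by
  have hcp := hN.completelyPositive
  have htp := hN.tracePreserving
  have hG := flippedChoi_posSemidef hcp
  have hsum := sum_eigenvalues_eq_one hG.1 (trace_flippedChoi htp)
  have hlog : 0 < Real.log 2 := Real.log_pos one_lt_two
  have hcard : Fintype.card (Fin 2 × Fin 2) = 4 := rfl
  rw [mutualInformation, traceRight_pdm htp, entropy_half_smul_one, traceLeft_pdm,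
    pdm_eq_half_sub_flippedChoi htp, entropy_smul_one_sub hG.1]
  rcases h with h | h
  · rw [show N 1 = 1 from h, entropy_half_smul_one]
    have hle := (div_le_iff₀ hlog).2 (sum_negMulLog_half_sub_le hcard hG.eigenvalues_nonneg hsum)
    have hge := (one_le_div hlog).2
      (log_two_le_sum_negMulLog_half_sub hcard hG.eigenvalues_nonneg hsum)
    constructor <;> linarith
  · rw [sum_negMulLog_half_sub_of_card_support_le hcard hsum
      (hG.1.rank_eq_card_non_zero_eigs ▸ rank_flippedChoi_le.trans h), div_self hlog.ne']
    have hB := entropy_qubit_state ((map_one_posSemidef hcp).smul (a := (1 / 2 : ℂ))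
      (by norm_num [Complex.le_def])) (by simp [Matrix.trace_smul, htp])
    constructor <;> linarith
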